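/- Let $\mathscr{R}$ be a nontrivial totally ordered abelian group (written multiplicatively) that is divisible, archimedean and conditionally complete, regarded as a bipotent semifield without zero with addition $a\dotplus b=\max(a,b)$ (so $\mathscr R\cong(\mathbb R_{>0},\max,\cdot)$), and let $n\ge 0$. Let $\mathscr{R}(x_1,\dots,x_n)$ be the semifield of functions $\mathscr R^n\to\mathscr R$ of the form $f=h/g$, where $h=\sum_{i=1}^k h_i$ and $g=\sum_{j=1}^m g_j$ are nonempty finite sums (that is, pointwise maxima) of distinct monomials $c\,x_1^{e_1}\cdots x_n^{e_n}$, $c\in\mathscr R$, $e_i\in\mathbb N$; operations are pointwise. A kernel of a semifield $\mathbb S$ is a subgroup $K$ of its multiplicative group such that $xa\dotplus yb\in K$ whenever $a,b\in K$ and $x,y\in\mathbb S$ satisfy $x\dotplus y=1$. The kernel $\langle A\rangle$ generated by $A\subseteq \mathbb S$ is the smallest kernel containing $A$. A kernel is principal if it equals $\langle f\rangle$ for some $f\in\mathbb S$, and $\mathrm{PCon}(\mathbb S)$ is the set of principal kernels of $\mathbb S$. Let $\langle\mathscr R\rangle$ be the kernel of $\mathscr R(x_1,\dots,x_n)$ generated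 by the constant functions; it is itself a semifield. An element $f$ of $\mathscr R(x_1,\dots,x_n)$ is corner-integral if it can be written as $f=h/g$ as above so that for every $x\in\mathscr R^n$: whenever $h_i(x)=h_j(x)$ with $i\ne j$, there is $t$ with $h_i(x)\le g_t(x)$ or there is $s\notin\{i,j\}$ with $h_s(x)>h_i(x)$; and the same holds with the roles of $h$ and $g$ exchanged. It is regular if it can be written as $f=h/g$ so that for every $x\in\mathscr R^n$ there are $i,j$ with $h(x)=h_i(x)$, $g(x)=g_j(x)$ and $h_i\ne g_j$. A principal kernel is corner-integral (respectively regular) if it has a corner-integral (respectively regular) generator. Then, for $\mathbb S=\mathscr R(x_1,\dots,x_n)$ and also for $\mathbb S=\langle\mathscr R\rangle$: 1. the lattice generated, under products and intersections, by the corner-integral principal kernels of $\mathbb S$ is $\mathrm{PCon}(\mathbb S)$; 2. the lattice generated, under products and intersections, by the principal kernels of $\mathbb S$ that are both regular and corner-integral is the set of all regular principal kernels of $\mathbb S$. -/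

import Mathlib

/-!
An idempotent semifield (without zero) is the same thing as a commutative lattice-ordered group:
its addition is the join `⊔`. A bipotent semifield is a linearly ordered commutative group, with
`a ⊔ b = max a b` as its addition.
-/

namespace PrincipalKernels

section Semifields

variable {G : Type*} [CommGroup G] [Lattice G]

/-- A subsemifield: closed under multiplication, inversion and addition. -/
structure Subsemifield (G : Type*) [CommGroup G] [Lattice G] extends Subgroup G where
  sup_mem' : ∀ {a b : G}, a ∈ carrier → b ∈ carrier → a ⊔ b ∈ carrier

/-- `K` is a (semifield-)kernel of the semifield `S`: a subgroup of `S` such that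
`x a + y b ∈ K` whenever `a, b ∈ K` and `x, y ∈ S` with `x + y = 1`. -/
structure IsKernel (S : Subsemifield G) (K : Subgroup G) : Prop where
  le : K ≤ S.toSubgroup
  convex : ∀ x ∈ S.toSubgroup, ∀ y ∈ S.toSubgroup, x ⊔ y = 1 →
    ∀ a ∈ K, ∀ b ∈ K, x * a ⊔ y * b ∈ K

/-- The smallest kernel of `S` containing `A` (for a subset `A` of `S`). -/
def kernelSpan (S : Subsemifield G) (A : Set G) : Subgroup G :=
  sInf {K | IsKernel S K ∧ A ⊆ K}

/-- For an idempotent semifield, a kernel generated by elements of it is itself a semifield. -/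
def kernelSemifield (S : Subsemifield G) (A : Set G) : Subsemifield G where
  toSubgroup := kernelSpan S A
  sup_mem' := by
    intro a b ha hb
    refine Subgroup.mem_sInf.2 fun K hK => ?_
    have h := hK.1.convex 1 (one_mem _) 1 (one_mem _) (sup_idem _)
      a (Subgroup.mem_sInf.1 ha K hK) b (Subgroup.mem_sInf.1 hb K hK)
    simpa using h

/-- The principal kernels `⟨f⟩`, `f ∈ S`, of the semifield `S`. -/
def PCon (S : Subsemifield G) : Set (Subgroup G) :=
  {K | ∃ f ∈ S.toSubgroup, K = kernelSpan S {f}}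

end Semifields

section Fractions

variable {R : Type*} [CommGroup R] [LinearOrder R] [IsOrderedMonoid R] {n : ℕ}

/-- A monomial `c x₁^{e₁} ⋯ xₙ^{eₙ}` with coefficient `c = m.1` and exponents `e = m.2`. -/
abbrev Mono (R : Type*) (n : ℕ) := R × (Fin n → ℕ)

/-- The value of a monomial at a point. -/
def Mono.value (m : Mono R n) (x : Fin n → R) : R := m.1 * ∏ i, x i ^ m.2 i

/-- A polynomial, written as the sum of its finitely many (at least one, and distinct) component
monomials. Two monomials with the same exponents and different coefficients are allowed; the
smaller one is then strictly dominated at every point. -/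
structure Poly (R : Type*) (n : ℕ) where
  monos : Finset (Mono R n)
  nonempty : monos.Nonempty

/-- The function defined by a polynomial; a sum is a maximum. -/
def Poly.eval (p : Poly R n) : (Fin n → R) → R :=
  fun x => p.monos.sup' p.nonempty fun m => m.value x

theorem Mono.value_mul (m m' : Mono R n) (x : Fin n → R) :
    Mono.value (m.1 * m'.1, m.2 + m'.2) x = m.value x * m'.value x := by
  simp only [Mono.value, Pi.add_apply, pow_add, Finset.prod_mul_distrib]
  exact mul_mul_mul_comm _ _ _ _

theorem Poly.value_le (p : Poly R n) {m : Mono R n} (hm : m ∈ p.monos) (x : Fin n → R) :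
    m.value x ≤ p.eval x :=
  Finset.le_sup' (fun m => Mono.value m x) hm

theorem Poly.exists_value (p : Poly R n) (x : Fin n → R) :
    ∃ m ∈ p.monos, p.eval x = m.value x :=
  Finset.exists_mem_eq_sup' p.nonempty _

theorem Poly.exists_mul (p q : Poly R n) : ∃ r : Poly R n, r.eval = p.eval * q.eval := by
  classical
  refine ⟨⟨Finset.image₂ (fun m m' => (m.1 * m'.1, m.2 + m'.2)) p.monos q.monos,
    p.nonempty.image₂ q.nonempty⟩, funext fun x => le_antisymm ?_ ?_⟩
  · refine Finset.sup'_le _ _ fun m hm => ?_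
    obtain ⟨a, ha, b, hb, rfl⟩ := Finset.mem_image₂.1 hm
    rw [Mono.value_mul]
    exact mul_le_mul' (p.value_le ha x) (q.value_le hb x)
  · obtain ⟨a, ha, hpa⟩ := p.exists_value x
    obtain ⟨b, hb, hqb⟩ := q.exists_value x
    rw [Pi.mul_apply, hpa, hqb, ← Mono.value_mul]
    exact Poly.value_le _ (Finset.mem_image₂_of_mem ha hb) x

theorem Poly.exists_add (p q : Poly R n) : ∃ r : Poly R n, r.eval = p.eval ⊔ q.eval := by
  classical
  exact ⟨⟨p.monos ∪ q.monos, p.nonempty.inl⟩,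
    funext fun x => Finset.sup'_union p.nonempty q.nonempty _⟩

/-- The semifield of fractions `R(x₁, …, xₙ)`: the functions `h / g` with polynomials `h`, `g`,
inside the semifield of all functions `Rⁿ → R` with pointwise operations. -/
def ratFun (R : Type*) [CommGroup R] [LinearOrder R] [IsOrderedMonoid R] (n : ℕ) :
    Subsemifield ((Fin n → R) → R) where
  carrier := {f | ∃ h g : Poly R n, f = h.eval / g.eval}
  mul_mem' := by
    rintro _ _ ⟨h, g, rfl⟩ ⟨h', g', rfl⟩
    obtain ⟨r, hr⟩ := h.exists_mul h'
    obtain ⟨s, hs⟩ := g.exists_mul g'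
    exact ⟨r, s, by rw [hr, hs, div_mul_div_comm]⟩
  one_mem' :=
    ⟨⟨{1}, Finset.singleton_nonempty _⟩, ⟨{1}, Finset.singleton_nonempty _⟩, (div_self' _).symm⟩
  inv_mem' := by
    rintro _ ⟨h, g, rfl⟩
    exact ⟨g, h, inv_div _ _⟩
  sup_mem' := by
    rintro _ _ ⟨h, g, rfl⟩ ⟨h', g', rfl⟩
    obtain ⟨a, ha⟩ := h.exists_mul g'
    obtain ⟨b, hb⟩ := h'.exists_mul g
    obtain ⟨r, hr⟩ := a.exists_add b
    obtain ⟨s, hs⟩ := g.exists_mul g'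
    refine ⟨r, s, funext fun x => ?_⟩
    simp only [hr, hs, ha, hb, Pi.sup_apply, Pi.mul_apply, Pi.div_apply]
    have key : ∀ a b c : R, (a ⊔ b) / c = a / c ⊔ b / c := fun a b c => by
      simp only [div_eq_mul_inv]
      exact max_mul_mul_right a b c⁻¹ |>.symm
    rw [key, mul_div_mul_right_eq_div, mul_comm (g.eval x), mul_div_mul_right_eq_div]

/-- The kernel `⟨R⟩` of `R(x₁, …, xₙ)` generated by the constant functions, as a semifield. -/
def constKernel (R : Type*) [CommGroup R] [LinearOrder R] [IsOrderedMonoid R] (n : ℕ) :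
    Subsemifield ((Fin n → R) → R) :=
  kernelSemifield (ratFun R n) (Set.range fun c : R => fun _ : Fin n → R => c)

/-- The condition on the corner roots of `h` in a fraction `h / g`: if two distinct monomials of `h`
agree at `x`, then their common value is surpassed at `x` by a monomial of `g`, or strictly by
another monomial of `h`. -/
def Surpassed (h g : Poly R n) : Prop :=
  ∀ x : Fin n → R, ∀ i ∈ h.monos, ∀ j ∈ h.monos, i ≠ j → i.value x = j.value x →
    (∃ t ∈ g.monos, i.value x ≤ t.value x) ∨
      ∃ s ∈ h.monos, s ≠ i ∧ s ≠ j ∧ i.value x < s.value x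

/-- `f` is corner-integral: it can be written as a fraction `h / g` in which the corner roots of `h`
are surpassed by `g` and those of `g` are surpassed by `h`. -/
def CornerIntegral (f : (Fin n → R) → R) : Prop :=
  ∃ h g : Poly R n, f = h.eval / g.eval ∧ Surpassed h g ∧ Surpassed g h

/-- `f` is regular: it can be written as a fraction `h / g` such that at every point there are a
dominant monomial of `h` and a dominant monomial of `g` that are distinct. -/
def Regular (f : (Fin n → R) → R) : Prop :=
  ∃ h g : Poly R n, f = h.eval / g.eval ∧
    ∀ x, ∃ i ∈ h.monos, ∃ j ∈ g.monos, h.eval x = i.value x ∧ g.eval x = j.value x ∧ i ≠ j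

/-- The principal kernels of `S` that have a corner-integral generator. -/
def CIPCon (S : Subsemifield ((Fin n → R) → R)) : Set (Subgroup ((Fin n → R) → R)) :=
  {K | ∃ f ∈ S.toSubgroup, K = kernelSpan S {f} ∧ CornerIntegral f}

/-- The principal kernels of `S` that have a regular generator. -/
def RegPCon (S : Subsemifield ((Fin n → R) → R)) : Set (Subgroup ((Fin n → R) → R)) :=
  {K | ∃ f ∈ S.toSubgroup, K = kernelSpan S {f} ∧ Regular f}

end Fractions

end PrincipalKernels

/-! Kernels are convex, so `⟨f⟩` consists of the `g` in the semifield with `|g| ≤ |f|^k` for some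
`k` (`mem_kernelSpan_singleton`). For `a, b ≥ 1`, products and intersections of `⟨a⟩`, `⟨b⟩` are
generated by `a ⊔ b` and `a ⊓ b` (`kernelSpan_sup`, `kernelSpan_inf`). The question thus concerns
functions `≥ 1`, compared up to powers.

Let `f = h / g`. At each point `|f| = |i / j|` for dominant monomials `i` of `h` and `j` of `g`. For
each such pair take a maximum `W`, over the monomials `b` of `h` and `g`, of functions comparable to
`|i / j| + b / i + b / j`. Where `i`, `j` dominate, `W ≤ |f|`; everywhere `|f| ≤ W³`, since `h / i`
and `g / j` are at most `W²`. So the minimum of the `W` over all pairs generates `⟨f⟩`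
(`kernelSpan_div_mem`).

For the first claim the building blocks are `u / v ⊔ 1` with monomials `u`, `v`. For the second they
are the quotients of the largest by the second largest value among `{i, j}` and `{i, j, b}` with `i
≠ j` (`exists_hypersurface_fraction`), which are regular as well as corner-integral. In `⟨R⟩` the
blocks are capped by a constant (`exists_truncation`).

Regularity of a rational function is equivalent to being `≠ 1` wherever suitable finitely many
monomials have distinct values, a condition visibly stable under the lattice operations on functions
`≥ 1`. -/

namespace PrincipalKernels

/-! ### Kernels as convex subgroups -/

section Kernels

variable {G : Type*} [CommGroup G] [Lattice G] {S : Subsemifield G}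

theorem Subsemifield.sup_mem (S : Subsemifield G) {a b : G} (ha : a ∈ S.toSubgroup)
    (hb : b ∈ S.toSubgroup) : a ⊔ b ∈ S.toSubgroup :=
  S.sup_mem' ha hb

theorem Subsemifield.mabs_mem (S : Subsemifield G) {a : G} (ha : a ∈ S.toSubgroup) :
    |a|ₘ ∈ S.toSubgroup :=
  S.sup_mem ha (inv_mem ha)

theorem IsKernel.mabs_mem {K : Subgroup G} (hK : IsKernel S K) {a : G} (ha : a ∈ K) :
    |a|ₘ ∈ K := by
  have h := hK.convex 1 (one_mem _) 1 (one_mem _) (sup_idem _) a ha a⁻¹ (inv_mem ha)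
  simpa [mabs] using h

variable [IsOrderedMonoid G]

theorem Subsemifield.inf_mem (S : Subsemifield G) {a b : G} (ha : a ∈ S.toSubgroup)
    (hb : b ∈ S.toSubgroup) : a ⊓ b ∈ S.toSubgroup := by
  have h := inv_mem (S.sup_mem (inv_mem ha) (inv_mem hb))
  rwa [← inv_inf, inv_inv] at h

/-- Convexity: `g = (g / u) * u ⊔ 1 * u⁻¹`, and the weights `g / u`, `1` have join `1` because `g ≤
u`. -/
theorem IsKernel.mem_of_mabs_le {K : Subgroup G} (hK : IsKernel S K) {u g : G}
    (hu : u ∈ K) (hg : g ∈ S.toSubgroup) (h : |g|ₘ ≤ u) : g ∈ K := by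
  have key := hK.convex (g / u) (div_mem hg (hK.le hu)) 1 (one_mem _)
    (sup_eq_right.2 (div_le_one'.2 ((le_mabs_self g).trans h))) u hu u⁻¹ (inv_mem hu)
  have h' : u⁻¹ ≤ g := inv_le'.1 ((inv_le_mabs g).trans h)
  rwa [div_mul_cancel, one_mul, sup_eq_left.2 h'] at key

/-- The elements of `S` whose absolute value is bounded by an element of `U`. -/
def boundedBy (S : Subsemifield G) (U : Submonoid G) : Subgroup G where
  carrier := {g | g ∈ S.toSubgroup ∧ ∃ u ∈ U, |g|ₘ ≤ u}
  mul_mem' := by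
    rintro a b ⟨ha, u, hu, hau⟩ ⟨hb, v, hv, hbv⟩
    exact ⟨mul_mem ha hb, u * v, mul_mem hu hv, (mabs_mul_le a b).trans (mul_le_mul' hau hbv)⟩
  one_mem' := ⟨one_mem _, 1, one_mem _, by simp⟩
  inv_mem' := by
    rintro a ⟨ha, u, hu, hau⟩
    exact ⟨inv_mem ha, u, hu, by rwa [mabs_inv]⟩

theorem mem_boundedBy {U : Submonoid G} {g : G} :
    g ∈ boundedBy S U ↔ g ∈ S.toSubgroup ∧ ∃ u ∈ U, |g|ₘ ≤ u :=
  Iff.rfl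

theorem mabs_mul_sup_mul_le {x y a b w : G} (hxy : x ⊔ y = 1) (ha : |a|ₘ ≤ w) (hb : |b|ₘ ≤ w) :
    |x * a ⊔ y * b|ₘ ≤ w := by
  have hx : x ≤ 1 := hxy ▸ le_sup_left
  have hy : y ≤ 1 := hxy ▸ le_sup_right
  refine mabs_le'.2 ⟨sup_le ?_ ?_, inv_le'.1 ?_⟩
  · simpa using mul_le_mul' hx ((le_mabs_self a).trans ha)
  · simpa using mul_le_mul' hy ((le_mabs_self b).trans hb)
  · have h1 : w⁻¹ ≤ a := inv_le'.1 ((inv_le_mabs a).trans ha)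
    have h2 : w⁻¹ ≤ b := inv_le'.1 ((inv_le_mabs b).trans hb)
    calc w⁻¹ = (x ⊔ y) * w⁻¹ := by rw [hxy, one_mul]
      _ = x * w⁻¹ ⊔ y * w⁻¹ := sup_mul ..
      _ ≤ x * a ⊔ y * b := sup_le_sup (mul_le_mul_right h1 x) (mul_le_mul_right h2 y)

theorem isKernel_boundedBy (S : Subsemifield G) (U : Submonoid G) :
    IsKernel S (boundedBy S U) where
  le _ hg := hg.1
  convex := by
    rintro x hx y hy hxy a ⟨ha, u, hu, hau⟩ b ⟨hb, v, hv, hbv⟩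
    refine ⟨S.sup_mem (mul_mem hx ha) (mul_mem hy hb), u * v, mul_mem hu hv,
      mabs_mul_sup_mul_le hxy (hau.trans ?_) (hbv.trans ?_)⟩
    · exact le_mul_of_one_le_right' ((one_le_mabs b).trans hbv)
    · exact le_mul_of_one_le_left' ((one_le_mabs a).trans hau)

/-- `boundedBy S U` is a kernel containing `A`; conversely a kernel containing `A` contains `U`,
hence by convexity everything bounded by `U`. -/
theorem kernelSpan_eq_boundedBy {A : Set G} {U : Submonoid G} (hA : A ⊆ S.toSubgroup)
    (hAU : ∀ a ∈ A, ∃ u ∈ U, |a|ₘ ≤ u) (hUA : ∀ K, IsKernel S K → A ⊆ K → U ≤ K.toSubmonoid) :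
    kernelSpan S A = boundedBy S U := by
  refine le_antisymm (sInf_le ⟨isKernel_boundedBy S U, fun a ha => ⟨hA ha, hAU a ha⟩⟩)
    (le_sInf ?_)
  rintro K ⟨hK, hAK⟩ g ⟨hg, u, hu, hgu⟩
  exact hK.mem_of_mabs_le (hUA K hK hAK hu) hg hgu

theorem kernelSpan_singleton {f : G} (hf : f ∈ S.toSubgroup) :
    kernelSpan S {f} = boundedBy S (Submonoid.powers |f|ₘ) := by
  refine kernelSpan_eq_boundedBy (by simpa using hf) ?_ ?_
  · rintro a rfl
    exact ⟨_, Submonoid.mem_powers _, le_rfl⟩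
  · intro K hK hfK
    exact Submonoid.powers_le.2 (hK.mabs_mem (hfK rfl))

theorem mem_kernelSpan_singleton {f g : G} (hf : f ∈ S.toSubgroup) :
    g ∈ kernelSpan S {f} ↔ g ∈ S.toSubgroup ∧ ∃ k : ℕ, |g|ₘ ≤ |f|ₘ ^ k := by
  rw [kernelSpan_singleton hf, mem_boundedBy]
  simp [Submonoid.mem_powers_iff]

theorem kernelSpan_le_kernelSpan {a b : G} (ha : a ∈ S.toSubgroup) (hb : b ∈ S.toSubgroup)
    {k : ℕ} (h : |a|ₘ ≤ |b|ₘ ^ k) : kernelSpan S {a} ≤ kernelSpan S {b} := by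
  intro g hg
  obtain ⟨hgS, l, hl⟩ := (mem_kernelSpan_singleton ha).1 hg
  refine (mem_kernelSpan_singleton hb).2 ⟨hgS, k * l, hl.trans ?_⟩
  rw [pow_mul]
  exact pow_le_pow_left' h l

theorem kernelSpan_mabs {a : G} (ha : a ∈ S.toSubgroup) :
    kernelSpan S {|a|ₘ} = kernelSpan S {a} :=
  le_antisymm (kernelSpan_le_kernelSpan (k := 1) (S.mabs_mem ha) ha (by simp))
    (kernelSpan_le_kernelSpan (k := 1) ha (S.mabs_mem ha) (by simp))

end Kernels

/-! ### The lattice of principal kernels of a semifield of functions -/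

section Functions

variable {X R : Type*} [CommGroup R] [LinearOrder R] [IsOrderedMonoid R]
  {S : Subsemifield (X → R)}

/-- Riesz decomposition at a point: clamping `g` to `[A⁻¹, A]` splits off a factor bounded by `A`,
and what remains is bounded by `B`. With `A = a ^ k`, `B = b ^ k` this factors elements of `⟨a ⊔
b⟩`. -/
theorem mabs_div_clamp_le {g A B : R} (hA : 1 ≤ A) (hB : 1 ≤ B) (hg : |g|ₘ ≤ A * B) :
    |g / ((g ⊓ A) ⊔ A⁻¹)|ₘ ≤ B := by
  obtain ⟨h1, h2⟩ := mabs_le'.1 hg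
  have hA' : A⁻¹ ≤ A := (inv_le_one'.2 hA).trans hA
  rcases le_total g A with h | h
  · rw [inf_eq_left.2 h]
    rcases le_total g A⁻¹ with h' | h'
    · rw [sup_eq_right.2 h', mabs_le', div_inv_eq_mul]
      refine ⟨le_trans ?_ hB, ?_⟩
      · simpa using mul_le_mul_left h' A
      · rw [mul_inv]
        exact mul_inv_le_iff_le_mul.2 (by rwa [mul_comm B])
    · rw [sup_eq_left.2 h', div_self', mabs_one]
      exact hB
  · rw [inf_eq_right.2 h, sup_eq_left.2 hA', mabs_of_one_le (one_le_div'.2 h)]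
    exact div_le_iff_le_mul'.2 h1

theorem kernelSpan_sup {a b : X → R} (ha : a ∈ S.toSubgroup) (hb : b ∈ S.toSubgroup)
    (ha1 : 1 ≤ a) (hb1 : 1 ≤ b) :
    kernelSpan S {a ⊔ b} = kernelSpan S {a} ⊔ kernelSpan S {b} := by
  have hab := S.sup_mem ha hb
  have hab1 : 1 ≤ a ⊔ b := ha1.trans le_sup_left
  refine le_antisymm (fun g hg => ?_) (sup_le ?_ ?_)
  · obtain ⟨hgS, k, hk⟩ := (mem_kernelSpan_singleton hab).1 hg
    rw [mabs_of_one_le hab1] at hk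
    have hA : 1 ≤ a ^ k := one_le_pow_of_one_le' ha1 k
    have hB : 1 ≤ b ^ k := one_le_pow_of_one_le' hb1 k
    have hgAB : |g|ₘ ≤ a ^ k * b ^ k := by
      rw [← mul_pow]
      exact hk.trans (pow_le_pow_left' (sup_le (le_mul_of_one_le_right' hb1)
        (le_mul_of_one_le_left' ha1)) k)
    have hu : (g ⊓ a ^ k) ⊔ (a ^ k)⁻¹ ∈ S.toSubgroup :=
      S.sup_mem (S.inf_mem hgS (pow_mem ha k)) (inv_mem (pow_mem ha k))
    refine Subgroup.mem_sup.2 ⟨(g ⊓ a ^ k) ⊔ (a ^ k)⁻¹, (mem_kernelSpan_singleton ha).2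
      ⟨hu, k, ?_⟩, g / ((g ⊓ a ^ k) ⊔ (a ^ k)⁻¹), (mem_kernelSpan_singleton hb).2
      ⟨div_mem hgS hu, k, ?_⟩, mul_div_cancel _ _⟩
    · rw [mabs_of_one_le ha1]
      exact mabs_le'.2 ⟨sup_le inf_le_right ((inv_le_one'.2 hA).trans hA),
        inv_le'.1 le_sup_right⟩
    · rw [mabs_of_one_le hb1]
      exact fun x => mabs_div_clamp_le (hA x) (hB x) (hgAB x)
  · exact kernelSpan_le_kernelSpan (k := 1) ha hab
      (by simp [mabs_of_one_le ha1, mabs_of_one_le hab1])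
  · exact kernelSpan_le_kernelSpan (k := 1) hb hab
      (by simp [mabs_of_one_le hb1, mabs_of_one_le hab1])

theorem kernelSpan_inf {a b : X → R} (ha : a ∈ S.toSubgroup) (hb : b ∈ S.toSubgroup)
    (ha1 : 1 ≤ a) (hb1 : 1 ≤ b) :
    kernelSpan S {a ⊓ b} = kernelSpan S {a} ⊓ kernelSpan S {b} := by
  have hab := S.inf_mem ha hb
  have hab1 : 1 ≤ a ⊓ b := le_inf ha1 hb1
  refine le_antisymm (le_inf ?_ ?_) ?_
  · exact kernelSpan_le_kernelSpan (k := 1) hab ha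
      (by simp [mabs_of_one_le ha1, mabs_of_one_le hab1])
  · exact kernelSpan_le_kernelSpan (k := 1) hab hb
      (by simp [mabs_of_one_le hb1, mabs_of_one_le hab1])
  · rintro g ⟨hga, hgb⟩
    obtain ⟨hgS, k, hk⟩ := (mem_kernelSpan_singleton ha).1 hga
    obtain ⟨-, l, hl⟩ := (mem_kernelSpan_singleton hb).1 hgb
    rw [mabs_of_one_le ha1] at hk
    rw [mabs_of_one_le hb1] at hl
    -- Pointwise `a ⊓ b` is one of `a`, `b`, so the larger exponent serves both cases.
    refine (mem_kernelSpan_singleton hab).2 ⟨hgS, k ⊔ l, fun x => ?_⟩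
    rw [mabs_of_one_le hab1]
    rcases le_total (a x) (b x) with h | h
    · simpa [inf_eq_left.2 h] using
        (hk x).trans (pow_le_pow_right' (ha1 x) (le_max_left k l))
    · simpa [inf_eq_right.2 h] using
        (hl x).trans (pow_le_pow_right' (hb1 x) (le_max_right k l))

theorem isSublattice_PCon (S : Subsemifield (X → R)) : IsSublattice (PCon S) where
  supClosed := by
    rintro _ ⟨f, hf, rfl⟩ _ ⟨g, hg, rfl⟩
    exact ⟨_, S.sup_mem (S.mabs_mem hf) (S.mabs_mem hg), by
      rw [kernelSpan_sup (S.mabs_mem hf) (S.mabs_mem hg) (one_le_mabs f) (one_le_mabs g),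
        kernelSpan_mabs hf, kernelSpan_mabs hg]⟩
  infClosed := by
    rintro _ ⟨f, hf, rfl⟩ _ ⟨g, hg, rfl⟩
    exact ⟨_, S.inf_mem (S.mabs_mem hf) (S.mabs_mem hg), by
      rw [kernelSpan_inf (S.mabs_mem hf) (S.mabs_mem hg) (one_le_mabs f) (one_le_mabs g),
        kernelSpan_mabs hf, kernelSpan_mabs hg]⟩

/-- The elements `a ≥ 1` of `S` with `⟨a⟩ ∈ L`. -/
def PositiveGen (S : Subsemifield (X → R)) (L : Set (Subgroup (X → R))) (a : X → R) : Prop :=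
  a ∈ S.toSubgroup ∧ 1 ≤ a ∧ kernelSpan S {a} ∈ L

theorem PositiveGen.sup {L : Set (Subgroup (X → R))} (hL : IsSublattice L) {a b : X → R}
    (ha : PositiveGen S L a) (hb : PositiveGen S L b) : PositiveGen S L (a ⊔ b) :=
  ⟨S.sup_mem ha.1 hb.1, ha.2.1.trans le_sup_left,
    kernelSpan_sup ha.1 hb.1 ha.2.1 hb.2.1 ▸ hL.supClosed ha.2.2 hb.2.2⟩

theorem PositiveGen.inf {L : Set (Subgroup (X → R))} (hL : IsSublattice L) {a b : X → R}
    (ha : PositiveGen S L a) (hb : PositiveGen S L b) : PositiveGen S L (a ⊓ b) :=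
  ⟨S.inf_mem ha.1 hb.1, le_inf ha.2.1 hb.2.1,
    kernelSpan_inf ha.1 hb.1 ha.2.1 hb.2.1 ▸ hL.infClosed ha.2.2 hb.2.2⟩

end Functions

/-! ### Generic points and regularity -/

section Genericity

variable {R : Type*} [CommGroup R] [LinearOrder R] [IsOrderedMonoid R] {n : ℕ}

theorem exists_one_lt_pow_lt [Nontrivial R] (hdiv : ∀ k : ℕ, k ≠ 0 → ∀ a : R, ∃ b : R, b ^ k = a)
    (s : Finset R) (hs : ∀ a ∈ s, 1 < a) (N : ℕ) : ∃ ε : R, 1 < ε ∧ ∀ a ∈ s, ε ^ N < a := by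
  obtain ⟨a, ha1, ha⟩ : ∃ a : R, 1 < a ∧ ∀ b ∈ s, a ≤ b := by
    rcases s.eq_empty_or_nonempty with rfl | hne
    · obtain ⟨a, ha⟩ := exists_one_lt' (α := R)
      exact ⟨a, ha, by simp⟩
    · exact ⟨s.min' hne, hs _ (s.min'_mem hne), fun b hb => s.min'_le b hb⟩
  obtain ⟨ε, rfl⟩ := hdiv (N + 1) (Nat.succ_ne_zero N) a
  have hε : 1 < ε := lt_of_not_ge fun h => ha1.not_ge (pow_le_one' h _)
  exact ⟨ε, hε, fun b hb => (pow_lt_pow_right' hε N.lt_succ_self).trans_le (ha b hb)⟩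

theorem Mono.value_update_mul (m : Mono R n) (x : Fin n → R) (i : Fin n) (ε : R) :
    m.value (Function.update x i (x i * ε)) = m.value x * ε ^ m.2 i := by
  have h (k : Fin n) : Function.update x i (x i * ε) k ^ m.2 k =
      x k ^ m.2 k * if k = i then ε ^ m.2 i else 1 := by
    rcases eq_or_ne k i with rfl | hk
    · simp [mul_pow]
    · simp [hk]
  simp only [Mono.value]
  rw [Finset.prod_congr rfl fun k _ => h k, Finset.prod_mul_distrib, Finset.prod_ite_eq']
  simp [mul_assoc]

/-- Distinct monomials that agree at `x` differ in some exponent, so scaling that coordinate by `ε >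
1` separates them. Divisibility provides an `ε` small enough to preserve the finitely many strict
inequalities at `x`. -/
theorem exists_separate_pair [Nontrivial R]
    (hdiv : ∀ k : ℕ, k ≠ 0 → ∀ a : R, ∃ b : R, b ^ k = a) (M : Finset (Mono R n))
    (x : Fin n → R) {p q : Mono R n} (hpq : p ≠ q) (hx : p.value x = q.value x) :
    ∃ y : Fin n → R, p.value y ≠ q.value y ∧
      ∀ r ∈ M, ∀ s ∈ M, r.value x < s.value x → r.value y < s.value y := by
  classical
  obtain ⟨i, hi⟩ : ∃ i, p.2 i ≠ q.2 i := by
    by_contra! h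
    refine hpq (Prod.ext ?_ (funext h))
    simpa [Mono.value, funext h] using hx
  obtain ⟨ε, hε, h⟩ := exists_one_lt_pow_lt hdiv
    (((M ×ˢ M).filter fun r => r.1.value x < r.2.value x).image
      fun r => r.2.value x / r.1.value x)
    (by
      simp only [Finset.mem_image, Finset.mem_filter]
      rintro _ ⟨r, ⟨-, hr⟩, rfl⟩
      exact one_lt_div'.2 hr)
    (M.sup fun m => m.2 i)
  refine ⟨Function.update x i (x i * ε), ?_, fun r hr s hs hrs => ?_⟩
  · rw [Mono.value_update_mul, Mono.value_update_mul, hx]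
    exact fun h => hi ((pow_right_strictMono' hε).injective (mul_left_cancel h))
  · rw [Mono.value_update_mul, Mono.value_update_mul]
    have h1 := h (s.value x / r.value x)
      (Finset.mem_image.2 ⟨(r, s), by simp [hr, hs, hrs], rfl⟩)
    have h2 : ε ^ r.2 i ≤ ε ^ M.sup fun m => m.2 i :=
      pow_le_pow_right' hε.le (Finset.le_sup (f := fun m : Mono R n => m.2 i) hr)
    calc r.value x * ε ^ r.2 i < r.value x * (s.value x / r.value x) :=
          mul_lt_mul_right (h2.trans_lt h1) _
      _ = s.value x := mul_div_cancel _ _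
      _ ≤ s.value x * ε ^ s.2 i := le_mul_of_one_le_right' (one_le_pow_of_one_le' hε.le _)

/-- Near any point there is one at which finitely many given monomials have distinct values. -/
theorem exists_injOn_value [Nontrivial R]
    (hdiv : ∀ k : ℕ, k ≠ 0 → ∀ a : R, ∃ b : R, b ^ k = a) (M : Finset (Mono R n))
    (x : Fin n → R) :
    ∃ y : Fin n → R, Set.InjOn (fun m : Mono R n => m.value y) M ∧
      ∀ r ∈ M, ∀ s ∈ M, r.value x < s.value x → r.value y < s.value y := by
  classical
  induction h : ((M ×ˢ M).filter fun r => r.1 ≠ r.2 ∧ r.1.value x = r.2.value x).card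
    using Nat.strong_induction_on generalizing x with
  | _ N ih =>
    by_cases hinj : Set.InjOn (fun m : Mono R n => m.value x) M
    · exact ⟨x, hinj, fun _ _ _ _ => id⟩
    obtain ⟨p, hp, q, hq, hval, hpq⟩ : ∃ p ∈ M, ∃ q ∈ M, p.value x = q.value x ∧ p ≠ q := by
      simpa [Set.InjOn] using hinj
    obtain ⟨y, hy, hxy⟩ := exists_separate_pair hdiv M x hpq hval
    -- Strict inequalities persist, so no new coincidence appears at `y`, while that of `p` and `q`
    -- is gone.
    have hlt : ((M ×ˢ M).filter fun r => r.1 ≠ r.2 ∧ r.1.value y = r.2.value y).card < N := by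
      refine h ▸ Finset.card_lt_card ((Finset.ssubset_iff_of_subset fun r hr => ?_).2
        ⟨(p, q), by simp [hp, hq, hval, hpq], by simp [hy]⟩)
      simp only [Finset.mem_filter, Finset.mem_product] at hr ⊢
      obtain ⟨⟨h1, h2⟩, h3, h4⟩ := hr
      refine ⟨⟨h1, h2⟩, h3, le_antisymm ?_ ?_⟩
      · exact le_of_not_gt fun hlt => (hxy _ h2 _ h1 hlt).ne' h4
      · exact le_of_not_gt fun hlt => (hxy _ h1 _ h2 hlt).ne h4
    obtain ⟨z, hz, hyz⟩ := ih _ hlt y rfl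
    exact ⟨z, hz, fun r hr s hs hrs => hyz r hr s hs (hxy r hr s hs hrs)⟩

/-- `f` differs from `1` wherever certain finitely many monomials have distinct values. -/
def GenericallyNeOne (f : (Fin n → R) → R) : Prop :=
  ∃ M : Finset (Mono R n), ∀ y, Set.InjOn (fun m : Mono R n => m.value y) M → f y ≠ 1

theorem Regular.genericallyNeOne {f : (Fin n → R) → R} (hf : Regular f) :
    GenericallyNeOne f := by
  classical
  obtain ⟨h, g, rfl, hreg⟩ := hf
  refine ⟨h.monos ∪ g.monos, fun y hy => ?_⟩
  obtain ⟨i, hi, j, hj, hiv, hjv, hij⟩ := hreg y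
  rw [Pi.div_apply, hiv, hjv, div_ne_one]
  exact fun h => hij (hy (by simp [hi]) (by simp [hj]) h)

/-- Every representation `h / g` works. Perturb `x` to a generic `y`: monomials dominant at `y` were
already dominant at `x`, since a strict defeat at `x` would persist, and `f y ≠ 1` forces those of
`h` and `g` to differ. -/
theorem GenericallyNeOne.regular [Nontrivial R]
    (hdiv : ∀ k : ℕ, k ≠ 0 → ∀ a : R, ∃ b : R, b ^ k = a) {f : (Fin n → R) → R}
    (hf : GenericallyNeOne f) (hfS : f ∈ (ratFun R n).toSubgroup) : Regular f := by
  classical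
  obtain ⟨M, hM⟩ := hf
  obtain ⟨h, g, rfl⟩ := hfS
  refine ⟨h, g, rfl, fun x => ?_⟩
  obtain ⟨y, hinj, hxy⟩ := exists_injOn_value hdiv (M ∪ (h.monos ∪ g.monos)) x
  have dominant (p : Poly R n) (hp : p.monos ⊆ M ∪ (h.monos ∪ g.monos)) {i : Mono R n}
      (hi : i ∈ p.monos) (hiy : p.eval y = i.value y) : p.eval x = i.value x := by
    refine le_antisymm (Finset.sup'_le _ _ fun m hm => le_of_not_gt fun hlt => ?_)
      (p.value_le hi x)
    exact ((p.value_le hm y).trans_eq hiy).not_gt (hxy _ (hp hi) _ (hp hm) hlt)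
  obtain ⟨i, hi, hiv⟩ := h.exists_value y
  obtain ⟨j, hj, hjv⟩ := g.exists_value y
  refine ⟨i, hi, j, hj, dominant h ?_ hi hiv, dominant g ?_ hj hjv, ?_⟩
  · exact Finset.subset_union_left.trans Finset.subset_union_right
  · exact Finset.subset_union_right.trans Finset.subset_union_right
  · rintro rfl
    refine hM y (hinj.mono (by simp)) ?_
    rw [Pi.div_apply, hiv, hjv, div_self']

theorem GenericallyNeOne.mabs {f : (Fin n → R) → R} (hf : GenericallyNeOne f) :
    GenericallyNeOne |f|ₘ :=
  hf.imp fun _ hM y hy h => hM y hy (mabs_eq_one.1 h)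

theorem GenericallyNeOne.sup {f g : (Fin n → R) → R} (hf : GenericallyNeOne f)
    (hf1 : 1 ≤ f) : GenericallyNeOne (f ⊔ g) :=
  hf.imp fun _ hM y hy h => hM y hy (le_antisymm (le_sup_left.trans_eq h) (hf1 y))

theorem GenericallyNeOne.inf {f g : (Fin n → R) → R} (hf : GenericallyNeOne f)
    (hg : GenericallyNeOne g) : GenericallyNeOne (f ⊓ g) := by
  classical
  obtain ⟨M, hM⟩ := hf
  obtain ⟨N, hN⟩ := hg
  refine ⟨M ∪ N, fun y hy h => ?_⟩
  rcases min_choice (f y) (g y) with h' | h'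
  · exact hM y (hy.mono (by simp)) (h'.symm.trans h)
  · exact hN y (hy.mono (by simp)) (h'.symm.trans h)

theorem isSublattice_RegPCon [Nontrivial R]
    (hdiv : ∀ k : ℕ, k ≠ 0 → ∀ a : R, ∃ b : R, b ^ k = a)
    {S : Subsemifield ((Fin n → R) → R)} (hS : S.toSubgroup ≤ (ratFun R n).toSubgroup) :
    IsSublattice (RegPCon S) where
  supClosed := by
    rintro _ ⟨f, hf, rfl, hfr⟩ _ ⟨g, hg, rfl, hgr⟩
    have h := S.sup_mem (S.mabs_mem hf) (S.mabs_mem hg)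
    refine ⟨_, h, ?_, (hfr.genericallyNeOne.mabs.sup (one_le_mabs f)).regular hdiv (hS h)⟩
    rw [kernelSpan_sup (S.mabs_mem hf) (S.mabs_mem hg) (one_le_mabs f) (one_le_mabs g),
      kernelSpan_mabs hf, kernelSpan_mabs hg]
  infClosed := by
    rintro _ ⟨f, hf, rfl, hfr⟩ _ ⟨g, hg, rfl, hgr⟩
    have h := S.inf_mem (S.mabs_mem hf) (S.mabs_mem hg)
    refine ⟨_, h, ?_,
      (hfr.genericallyNeOne.mabs.inf hgr.genericallyNeOne.mabs).regular hdiv (hS h)⟩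
    rw [kernelSpan_inf (S.mabs_mem hf) (S.mabs_mem hg) (one_le_mabs f) (one_le_mabs g),
      kernelSpan_mabs hf, kernelSpan_mabs hg]

end Genericity

/-! ### Corner-integral building blocks -/

section CornerIntegral

variable {R : Type*} [CommGroup R] [LinearOrder R] {n : ℕ}

/-- The product of two monomials. -/
def Mono.prod (m m' : Mono R n) : Mono R n := (m.1 * m'.1, m.2 + m'.2)

/-- `f` can be written as a fraction `h / g ≥ 1` in which the corner roots of `h` are surpassed
by `g`. -/
def CornerIntegralGeOne (f : (Fin n → R) → R) : Prop :=
  ∃ h g : Poly R n, f = h.eval / g.eval ∧ g.eval ≤ h.eval ∧ Surpassed h g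

variable [IsOrderedMonoid R]

theorem Mono.value_prod (m m' : Mono R n) (x : Fin n → R) :
    (m.prod m').value x = m.value x * m'.value x :=
  Mono.value_mul m m' x

theorem CornerIntegralGeOne.one_le {f : (Fin n → R) → R} (hf : CornerIntegralGeOne f) :
    1 ≤ f := by
  obtain ⟨h, g, rfl, hgh, -⟩ := hf
  exact one_le_div'.2 hgh

/-- Since `g ≤ h` everywhere, a dominant monomial of `h` surpasses every monomial of `g`, in
particular at its corners. -/
theorem CornerIntegralGeOne.cornerIntegral {f : (Fin n → R) → R} (hf : CornerIntegralGeOne f) :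
    CornerIntegral f := by
  obtain ⟨h, g, rfl, hgh, hs⟩ := hf
  refine ⟨h, g, rfl, hs, fun x i hi _ _ _ _ => Or.inl ?_⟩
  obtain ⟨t, ht, htx⟩ := h.exists_value x
  exact ⟨t, ht, (g.value_le hi x).trans ((hgh x).trans_eq htx)⟩

theorem CornerIntegralGeOne.mem_ratFun {f : (Fin n → R) → R} (hf : CornerIntegralGeOne f) :
    f ∈ (ratFun R n).toSubgroup := by
  obtain ⟨h, g, hfg, -⟩ := hf
  exact ⟨h, g, hfg⟩

/-- The constant `c`, as a monomial. -/
def Mono.const (n : ℕ) (c : R) : Mono R n := (c, 0)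

theorem Mono.value_const (c : R) (x : Fin n → R) : (Mono.const n c).value x = c := by
  simp [Mono.const, Mono.value]

theorem Mono.const_prod_injective (c : R) :
    Function.Injective (Mono.prod (Mono.const n c)) := by
  rintro ⟨a, e⟩ ⟨b, e'⟩ h
  simpa [Mono.prod, Mono.const] using h

/-- `h / g ⊓ c = c h / (h ⊔ c g)`: corners of `c h` are those of `h`, and the monomials of `c g`
that surpass them occur in the new denominator. -/
theorem CornerIntegralGeOne.inf_const {f : (Fin n → R) → R} (hf : CornerIntegralGeOne f) {c : R}
    (hc : 1 ≤ c) : CornerIntegralGeOne (f ⊓ fun _ => c) := by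
  classical
  obtain ⟨h, g, rfl, hgh, hs⟩ := hf
  let scale (p : Poly R n) : Poly R n :=
    ⟨p.monos.image (Mono.const n c).prod, p.nonempty.image _⟩
  have hscale (p : Poly R n) (x : Fin n → R) : (scale p).eval x = c * p.eval x := by
    refine le_antisymm (Finset.sup'_le _ _ fun m hm => ?_) ?_
    · obtain ⟨a, ha, rfl⟩ := Finset.mem_image.1 hm
      rw [Mono.value_prod, Mono.value_const]
      exact mul_le_mul_right (p.value_le ha x) c
    · obtain ⟨a, ha, hax⟩ := p.exists_value x
      rw [hax, ← Mono.value_const (n := n) c x, ← Mono.value_prod]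
      exact (scale p).value_le (Finset.mem_image_of_mem _ ha) x
  let k : Poly R n := ⟨h.monos ∪ (scale g).monos, h.nonempty.inl⟩
  have hk (x : Fin n → R) : k.eval x = h.eval x ⊔ c * g.eval x := by
    rw [← hscale]
    exact Finset.sup'_union h.nonempty (scale g).nonempty _
  refine ⟨scale h, k, funext fun x => ?_, fun x => ?_, ?_⟩
  · change h.eval x / g.eval x ⊓ c = (scale h).eval x / k.eval x
    rw [hk, hscale]
    rcases le_total (h.eval x) (c * g.eval x) with hx | hx
    · rw [sup_eq_right.2 hx, inf_eq_left.2 (div_le_iff_le_mul.2 hx),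
        mul_div_mul_left_eq_div]
    · rw [sup_eq_left.2 hx, inf_eq_right.2 (le_div_iff_mul_le.2 hx), mul_div_cancel_right]
  · rw [hk, hscale]
    exact sup_le (le_mul_of_one_le_left' hc) (mul_le_mul_right (hgh x) c)
  · rintro x _ hi _ hj hij hv
    obtain ⟨i, hi', rfl⟩ := Finset.mem_image.1 hi
    obtain ⟨j, hj', rfl⟩ := Finset.mem_image.1 hj
    simp only [Mono.value_prod] at hv ⊢
    rcases hs x i hi' j hj' (fun h => hij (h ▸ rfl)) (mul_left_cancel hv) with
      ⟨t, ht, hit⟩ | ⟨s, hsm, hsi, hsj, hlt⟩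
    · refine Or.inl ⟨(Mono.const n c).prod t,
        Finset.mem_union_right _ (Finset.mem_image_of_mem _ ht), ?_⟩
      rw [Mono.value_prod]
      exact mul_le_mul_right hit _
    · refine Or.inr ⟨(Mono.const n c).prod s, Finset.mem_image_of_mem _ hsm,
        (Mono.const_prod_injective c).ne hsi, (Mono.const_prod_injective c).ne hsj, ?_⟩
      rw [Mono.value_prod]
      exact mul_lt_mul_right hlt _

/-- Write it as `(u ⊔ v) / v`: at a corner of the numerator the common value is that of `v`. -/
theorem cornerIntegralGeOne_div_sup_one (u v : Mono R n) :
    CornerIntegralGeOne (fun x => u.value x / v.value x ⊔ 1) := by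
  classical
  have hv (x : Fin n → R) : (⟨{v}, Finset.singleton_nonempty v⟩ : Poly R n).eval x = v.value x :=
    Finset.sup'_singleton _
  have hu (x : Fin n → R) :
      (⟨{u, v}, Finset.insert_nonempty u {v}⟩ : Poly R n).eval x = u.value x ⊔ v.value x := by
    simp [Poly.eval]
  refine ⟨⟨{u, v}, Finset.insert_nonempty u {v}⟩, ⟨{v}, Finset.singleton_nonempty v⟩,
    funext fun x => ?_, fun x => ?_, fun x i hi j hj hij hval => Or.inl ⟨v, by simp, ?_⟩⟩
  · rw [Pi.div_apply, hu, hv, div_eq_mul_inv, div_eq_mul_inv, sup_mul, mul_inv_cancel]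
  · rw [hu, hv]
    exact le_sup_right
  · simp only [Finset.mem_insert, Finset.mem_singleton] at hi hj
    rcases hi with rfl | rfl
    · rcases hj with rfl | rfl
      · exact (hij rfl).elim
      · exact hval.le
    · exact le_rfl

/-- The quotient of the largest by the second largest of the values of at least two monomials:
it is `1` precisely on the tropical hypersurface of their sum. -/
theorem exists_hypersurface_fraction {P : Finset (Mono R n)} (hP : P.Nontrivial) :
    ∃ F : (Fin n → R) → R, CornerIntegralGeOne F ∧ GenericallyNeOne F ∧
      (∀ x, ∀ p ∈ P, ∀ m : R, (∀ q ∈ P, q ≠ p → q.value x ≤ m) → p.value x / m ≤ F x) ∧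
      ∀ x, ∀ i ∈ P, ∀ j ∈ P, i ≠ j → (∀ p ∈ P, p.value x ≤ i.value x ⊔ j.value x) →
        F x ≤ |i.value x / j.value x|ₘ := by
  classical
  obtain ⟨a, ha, b, hb, hab⟩ := hP
  -- If `M ≥ m` are the two largest values, counted with multiplicity, then the sum of squares is
  -- `M²` and the sum of mixed products is `M m`, with quotient `M / m`.
  let h : Poly R n := ⟨P.image fun p => p.prod p, ⟨_, Finset.mem_image_of_mem _ ha⟩⟩
  let g : Poly R n := ⟨P.offDiag.image fun r => r.1.prod r.2,
    ⟨_, Finset.mem_image_of_mem _ (Finset.mem_offDiag.2 ⟨ha, hb, hab⟩ : (a, b) ∈ P.offDiag)⟩⟩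
  have le_h (x) {p : Mono R n} (hp : p ∈ P) : p.value x * p.value x ≤ h.eval x := by
    rw [← Mono.value_prod]
    exact h.value_le (Finset.mem_image_of_mem _ hp) x
  have le_g (x) {p q : Mono R n} (hp : p ∈ P) (hq : q ∈ P) (hpq : p ≠ q) :
      p.value x * q.value x ≤ g.eval x := by
    rw [← Mono.value_prod]
    exact g.value_le (Finset.mem_image.2 ⟨(p, q), Finset.mem_offDiag.2 ⟨hp, hq, hpq⟩, rfl⟩) x
  have exists_h (x) : ∃ p ∈ P, h.eval x = p.value x * p.value x := by
    obtain ⟨_, hm, hmx⟩ := h.exists_value x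
    obtain ⟨p, hp, rfl⟩ := Finset.mem_image.1 hm
    exact ⟨p, hp, by rw [hmx, Mono.value_prod]⟩
  have exists_g (x) : ∃ p ∈ P, ∃ q ∈ P, p ≠ q ∧ p.value x ≤ q.value x ∧
      g.eval x = p.value x * q.value x := by
    obtain ⟨_, hm, hmx⟩ := g.exists_value x
    obtain ⟨⟨p, q⟩, hpq, rfl⟩ := Finset.mem_image.1 hm
    obtain ⟨hp, hq, hpq⟩ := Finset.mem_offDiag.1 hpq
    rw [Mono.value_prod] at hmx
    rcases le_total (p.value x) (q.value x) with hle | hle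
    · exact ⟨p, hp, q, hq, hpq, hle, hmx⟩
    · exact ⟨q, hq, p, hp, hpq.symm, hle, by rw [hmx, mul_comm]⟩
  have g_le_h : g.eval ≤ h.eval := fun x => by
    obtain ⟨p, hp, q, hq, -, hle, hx⟩ := exists_g x
    rw [hx]
    exact (mul_le_mul_left hle _).trans (le_h x hq)
  refine ⟨h.eval / g.eval, ⟨h, g, rfl, g_le_h, ?_⟩, ⟨P, fun x hinj hx => ?_⟩, ?_, ?_⟩
  · rintro x _ hi _ hj hij hv
    obtain ⟨p, hp, rfl⟩ := Finset.mem_image.1 hi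
    obtain ⟨q, hq, rfl⟩ := Finset.mem_image.1 hj
    simp only [Mono.value_prod] at hv ⊢
    have hpq : p ≠ q := fun h => hij (h ▸ rfl)
    have hval : p.value x = q.value x := by
      rcases lt_trichotomy (p.value x) (q.value x) with h | h | h
      · exact ((mul_lt_mul_of_lt_of_lt h h).ne hv).elim
      · exact h
      · exact ((mul_lt_mul_of_lt_of_lt h h).ne' hv).elim
    -- Where `p² = q²`, also `p = q` in value, so the mixed product `p q` of the denominator attains
    -- the same value.
    refine Or.inl ⟨p.prod q,
      Finset.mem_image.2 ⟨(p, q), Finset.mem_offDiag.2 ⟨hp, hq, hpq⟩, rfl⟩, ?_⟩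
    rw [Mono.value_prod, hval]
  · obtain ⟨p, hp, q, hq, hpq, hle, hgx⟩ := exists_g x
    have hlt : p.value x < q.value x := lt_of_le_of_ne hle fun h => hpq (hinj hp hq h)
    rw [Pi.div_apply, div_eq_one, hgx] at hx
    exact ((mul_lt_mul_left hlt _).trans_le (le_h x hq)).ne' hx
  · intro x p hp m hm
    rcases le_total m (p.value x) with hmp | hmp
    · have hg : g.eval x ≤ p.value x * m := by
        obtain ⟨q, hq, q', hq', hne, -, hgx⟩ := exists_g x
        rw [hgx]
        rcases eq_or_ne q p with rfl | hqp
        · exact mul_le_mul_right (hm q' hq' hne.symm) _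
        · rcases eq_or_ne q' p with rfl | hqp'
          · rw [mul_comm]
            exact mul_le_mul_right (hm q hq hne) _
          · exact mul_le_mul' ((hm q hq hqp).trans hmp) (hm q' hq' hqp')
      rw [Pi.div_apply, div_le_div_iff']
      calc p.value x * g.eval x ≤ p.value x * (p.value x * m) := mul_le_mul_right hg _
        _ = p.value x * p.value x * m := (mul_assoc _ _ _).symm
        _ ≤ h.eval x * m := mul_le_mul_left (le_h x hp) m
    · exact (div_le_one'.2 hmp).trans (one_le_div'.2 (g_le_h x))
  · intro x i hi j hj hij hmax
    obtain ⟨p, hp, hpx⟩ := exists_h x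
    have hx : h.eval x ≤ (i.value x ⊔ j.value x) * (i.value x ⊔ j.value x) := by
      rw [hpx]
      exact mul_le_mul' (hmax p hp) (hmax p hp)
    rw [← max_div_min_eq_mabs', Pi.div_apply, div_le_div_iff']
    calc h.eval x * (i.value x ⊓ j.value x)
        ≤ (i.value x ⊔ j.value x) * (i.value x ⊔ j.value x) * (i.value x ⊓ j.value x) :=
          mul_le_mul_left hx _
      _ = (i.value x ⊔ j.value x) * (i.value x * j.value x) := by
          rw [mul_assoc, mul_comm (i.value x ⊔ j.value x) (i.value x ⊓ j.value x),
            inf_mul_sup]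
      _ ≤ (i.value x ⊔ j.value x) * g.eval x := mul_le_mul_right (le_g x hi hj hij) _

end CornerIntegral

/-! ### Bounded functions and truncation -/

section Truncation

variable {R : Type*} [CommGroup R] [LinearOrder R] [IsOrderedMonoid R] {n : ℕ}

theorem const_mem_ratFun (c : R) : (fun _ => c) ∈ (ratFun R n).toSubgroup := by
  refine ⟨⟨{Mono.const n c}, Finset.singleton_nonempty _⟩,
    ⟨{Mono.const n 1}, Finset.singleton_nonempty _⟩, funext fun x => ?_⟩
  simp [Poly.eval, Mono.value_const]

theorem mem_constKernel {f : (Fin n → R) → R} :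
    f ∈ (constKernel R n).toSubgroup ↔
      f ∈ (ratFun R n).toSubgroup ∧ ∃ c : R, |f|ₘ ≤ fun _ => c := by
  have h : (constKernel R n).toSubgroup =
      boundedBy (ratFun R n) (MonoidHom.mrange (Pi.constMonoidHom (Fin n → R) R)) := by
    refine kernelSpan_eq_boundedBy ?_ ?_ ?_
    · rintro _ ⟨c, rfl⟩
      exact const_mem_ratFun c
    · rintro _ ⟨c, rfl⟩
      exact ⟨_, ⟨|c|ₘ, rfl⟩, fun x => le_rfl⟩
    · rintro K - hK _ ⟨c, rfl⟩
      exact hK ⟨c, rfl⟩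
  rw [h, mem_boundedBy]
  simp only [MonoidHom.mem_mrange, exists_exists_eq_and]
  rfl

theorem constKernel_le_ratFun : (constKernel R n).toSubgroup ≤ (ratFun R n).toSubgroup :=
  fun _ hf => (mem_constKernel.1 hf).1

/-- In `⟨R⟩` every element is bounded, so `u` is capped by a constant bounding `|f|`. Where the cap
takes effect, `D` already dominates `|f|`, so nothing is lost in bounding `f`. -/
theorem exists_truncation [Nontrivial R] {S : Subsemifield ((Fin n → R) → R)}
    (hS : S = ratFun R n ∨ S = constKernel R n) {f u : (Fin n → R) → R} (hf : f ∈ S.toSubgroup)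
    (hu : CornerIntegralGeOne u) :
    ∃ D ∈ S.toSubgroup, CornerIntegralGeOne D ∧ D ≤ u ∧ (∀ x, |f x|ₘ ≤ D x ∨ u x ≤ D x) ∧
      (GenericallyNeOne u → GenericallyNeOne D) := by
  rcases hS with rfl | rfl
  · exact ⟨u, hu.mem_ratFun, hu, le_rfl, fun x => Or.inr le_rfl, id⟩
  · obtain ⟨-, c, hc⟩ := mem_constKernel.1 hf
    -- The bound `c` may be `1`; joining it with `d > 1` prevents the cap from making `D` equal to
    -- `1` at generic points.
    obtain ⟨d, hd⟩ := exists_one_lt' (α := R)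
    have h1 : 1 < c ⊔ d := hd.trans_le le_sup_right
    have hD := hu.inf_const h1.le
    refine ⟨_, mem_constKernel.2 ⟨hD.mem_ratFun, c ⊔ d, ?_⟩, hD, inf_le_left, fun x => ?_, ?_⟩
    · rw [mabs_of_one_le hD.one_le]
      exact inf_le_right
    · rcases le_total (u x) (c ⊔ d) with h | h
      · exact Or.inr (le_inf le_rfl h)
      · exact Or.inl (le_inf (((hc x).trans le_sup_left).trans h) ((hc x).trans le_sup_left))
    · rintro ⟨M, hM⟩
      refine ⟨M, fun y hy h => ?_⟩
      rcases min_choice (u y) (c ⊔ d) with h' | h'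
      · exact hM y hy (h'.symm.trans h)
      · exact h1.ne' (h'.symm.trans h)

end Truncation

/-! ### Generating principal kernels from the building blocks -/

section Generation

variable {R : Type*} [CommGroup R] [LinearOrder R] [IsOrderedMonoid R] {n : ℕ}

/-- Applied with `a`, `b` the values of `h`, `g` and `p`, `q` those of chosen monomials, dominant or
not: `a / b ≤ a / q = (a / p) * (p / q)`, and symmetrically. -/
theorem mabs_div_le_of_le {a b p q w : R} (hpa : p ≤ a) (hqb : q ≤ b) (hap : a / p ≤ w ^ 2)
    (hbq : b / q ≤ w ^ 2) (hpq : |p / q|ₘ ≤ w) : |a / b|ₘ ≤ w ^ 3 := by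
  obtain ⟨h1, h2⟩ := mabs_le'.1 hpq
  rw [inv_div] at h2
  refine mabs_le'.2 ⟨?_, ?_⟩
  · calc a / b ≤ a / q := div_le_div_left' hqb a
      _ = a / p * (p / q) := (div_mul_div_cancel a p q).symm
      _ ≤ w ^ 2 * w := mul_le_mul' hap h1
      _ = w ^ 3 := (pow_succ w 2).symm
  · calc (a / b)⁻¹ = b / a := inv_div a b
      _ ≤ b / p := div_le_div_left' hpa b
      _ = b / q * (q / p) := (div_mul_div_cancel b q p).symm
      _ ≤ w ^ 2 * w := mul_le_mul' hbq h2
      _ = w ^ 3 := (pow_succ w 2).symm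

/-- If `I` contains a pair of dominant monomials of `h` and `g` at every point, then `⟨h / g⟩` is
the intersection over `(i, j) ∈ I` of products over the monomials `b` of `h` and `g` of
kernels whose generator is, locally, comparable to `|i / j| + b / i + b / j`. -/
theorem kernelSpan_div_mem {S : Subsemifield ((Fin n → R) → R)}
    {L : Set (Subgroup ((Fin n → R) → R))} (hL : IsSublattice L) {h g : Poly R n}
    (hf : h.eval / g.eval ∈ S.toSubgroup) (I : Finset (Mono R n × Mono R n))
    (hI : ∀ r ∈ I, r.1 ∈ h.monos ∧ r.2 ∈ g.monos)
    (hdom : ∀ x, ∃ r ∈ I, h.eval x = r.1.value x ∧ g.eval x = r.2.value x)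
    (hD : ∀ r ∈ I, ∀ b : Mono R n, ∃ D, PositiveGen S L D ∧
      (∀ x, |(h.eval / g.eval) x|ₘ ≤ D x ∨ (b.value x / r.1.value x ≤ D x ^ 2 ∧
        b.value x / r.2.value x ≤ D x ^ 2 ∧ |r.1.value x / r.2.value x|ₘ ≤ D x)) ∧
      ∀ x, b.value x ≤ r.1.value x ⊔ r.2.value x →
        D x ≤ |r.1.value x / r.2.value x|ₘ) :
    kernelSpan S {h.eval / g.eval} ∈ L := by
  classical
  choose! D hpos hlow hupp using hD
  obtain ⟨r₀, hr₀, -⟩ := hdom 1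
  have hne : I.Nonempty := ⟨r₀, hr₀⟩
  have hB : (h.monos ∪ g.monos).Nonempty := h.nonempty.inl
  let W (r : Mono R n × Mono R n) := (h.monos ∪ g.monos).sup' hB (D r)
  have hW (r) (x) {b} (hb : b ∈ h.monos ∪ g.monos) : D r b x ≤ W r x :=
    Finset.le_sup' (D r) hb x
  have hWpos (r) (hr : r ∈ I) : PositiveGen S L (W r) :=
    Finset.sup'_induction _ _ (fun _ ha _ hb => ha.sup hL hb) fun b _ => hpos r hr b
  have hT : PositiveGen S L (I.inf' hne W) :=
    Finset.inf'_induction _ _ (fun _ ha _ hb => ha.inf hL hb) hWpos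
  have hle (x) : |(h.eval / g.eval) x|ₘ ≤ (I.inf' hne W) x ^ 3 := by
    rw [Finset.inf'_apply]
    obtain ⟨r, hr, hrx⟩ := Finset.exists_mem_eq_inf' hne fun r => W r x
    rw [hrx]
    have hW1 : 1 ≤ W r x := (hWpos r hr).2.1 x
    by_cases hcase : ∃ b ∈ h.monos ∪ g.monos, |(h.eval / g.eval) x|ₘ ≤ D r b x
    · obtain ⟨b, hb, hbx⟩ := hcase
      exact (hbx.trans (hW r x hb)).trans (le_self_pow hW1 three_ne_zero)
    · push Not at hcase
      have key {b} (hb : b ∈ h.monos ∪ g.monos) := (hlow r hr b x).resolve_left (hcase b hb).not_ge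
      have hsq {b} (hb : b ∈ h.monos ∪ g.monos) : D r b x ^ 2 ≤ W r x ^ 2 :=
        pow_le_pow_left' (hW r x hb) 2
      obtain ⟨i, hi, hix⟩ := h.exists_value x
      obtain ⟨j, hj, hjx⟩ := g.exists_value x
      have hi' := Finset.mem_union_left g.monos hi
      have hj' := Finset.mem_union_right h.monos hj
      refine mabs_div_le_of_le (h.value_le (hI r hr).1 x) (g.value_le (hI r hr).2 x) ?_ ?_
        ((key hi').2.2.trans (hW r x hi'))
      · rw [hix]
        exact (key hi').1.trans (hsq hi')
      · rw [hjx]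
        exact (key hj').2.1.trans (hsq hj')
  -- Here only the pair dominant at `x` matters: for it, every monomial is at most `r.1 ⊔ r.2`, so
  -- `hupp` applies.
  have hge (x) : (I.inf' hne W) x ≤ |(h.eval / g.eval) x|ₘ := by
    obtain ⟨r, hr, hrh, hrg⟩ := hdom x
    refine (Finset.inf'_le W hr x).trans ?_
    rw [Pi.div_apply, hrh, hrg]
    simp only [W, Finset.sup'_apply]
    refine Finset.sup'_le _ _ fun b hb => hupp r hr b x ?_
    rcases Finset.mem_union.1 hb with hb | hb
    · exact ((h.value_le hb x).trans_eq hrh).trans le_sup_left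
    · exact ((g.value_le hb x).trans_eq hrg).trans le_sup_right
  have heq : kernelSpan S {h.eval / g.eval} = kernelSpan S {I.inf' hne W} := by
    refine le_antisymm (kernelSpan_le_kernelSpan (k := 3) hf hT.1 ?_)
      (kernelSpan_le_kernelSpan (k := 1) hT.1 hf ?_)
    · rw [mabs_of_one_le hT.2.1]
      exact hle
    · rw [mabs_of_one_le hT.2.1, pow_one]
      exact hge
  exact heq ▸ hT.2.2

variable {S : Subsemifield ((Fin n → R) → R)}

theorem positiveGen_CIPCon {D : (Fin n → R) → R} (hDS : D ∈ S.toSubgroup)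
    (hD : CornerIntegralGeOne D) : PositiveGen S (latticeClosure (CIPCon S)) D :=
  ⟨hDS, hD.one_le, subset_latticeClosure ⟨D, hDS, rfl, hD.cornerIntegral⟩⟩

/-- For `r = (i, j)` and `b`, join the truncations of `i / j ⊔ 1`, `j / i ⊔ 1` and `b / i ⊔ 1`. The
bound on `b / j = (b / i) * (i / j)` is what requires a square. -/
theorem PCon_subset_latticeClosure [Nontrivial R] (hS : S = ratFun R n ∨ S = constKernel R n)
    (hle : S.toSubgroup ≤ (ratFun R n).toSubgroup) :
    PCon S ⊆ latticeClosure (CIPCon S) := by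
  rintro _ ⟨f, hf, rfl⟩
  obtain ⟨h, g, rfl⟩ := hle hf
  have hL : IsSublattice (latticeClosure (CIPCon S)) := isSublattice_latticeClosure
  have order (u v : Mono R n) := exists_truncation hS hf (cornerIntegralGeOne_div_sup_one u v)
  choose D hDS hD hDle hlow _ using order
  have hpos (u v) : PositiveGen S (latticeClosure (CIPCon S)) (D u v) :=
    positiveGen_CIPCon (hDS u v) (hD u v)
  refine kernelSpan_div_mem hL hf (h.monos ×ˢ g.monos) (by simp) (fun x => ?_) fun r hr b =>
    ⟨D r.1 r.2 ⊔ D r.2 r.1 ⊔ D b r.1, ((hpos _ _).sup hL (hpos _ _)).sup hL (hpos _ _),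
      fun x => ?_, fun x hb => ?_⟩
  · obtain ⟨i, hi, hix⟩ := h.exists_value x
    obtain ⟨j, hj, hjx⟩ := g.exists_value x
    exact ⟨(i, j), by simp [hi, hj], hix, hjx⟩
  · have h1 : D r.1 r.2 x ≤ (D r.1 r.2 ⊔ D r.2 r.1 ⊔ D b r.1) x := le_sup_left.trans le_sup_left
    have h2 : D r.2 r.1 x ≤ (D r.1 r.2 ⊔ D r.2 r.1 ⊔ D b r.1) x := le_sup_right.trans le_sup_left
    have h3 : D b r.1 x ≤ (D r.1 r.2 ⊔ D r.2 r.1 ⊔ D b r.1) x := le_sup_right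
    generalize (D r.1 r.2 ⊔ D r.2 r.1 ⊔ D b r.1) x = w at h1 h2 h3
    rcases hlow r.1 r.2 x with h4 | h4
    · exact Or.inl (h4.trans h1)
    rcases hlow r.2 r.1 x with h5 | h5
    · exact Or.inl (h5.trans h2)
    rcases hlow b r.1 x with h6 | h6
    · exact Or.inl (h6.trans h3)
    have hij := (le_sup_left.trans h4).trans h1
    have hji := (le_sup_left.trans h5).trans h2
    have hbi := (le_sup_left.trans h6).trans h3
    have hw := (le_sup_right.trans h6).trans h3
    refine Or.inr ⟨hbi.trans (le_self_pow hw two_ne_zero), ?_,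
      mabs_le'.2 ⟨hij, by rwa [inv_div]⟩⟩
    rw [← div_mul_div_cancel _ (r.1.value x), sq]
    exact mul_le_mul' hbi hij
  · refine sup_le (sup_le ((hDle _ _ x).trans ?_) ((hDle _ _ x).trans ?_))
      ((hDle _ _ x).trans ?_)
    · exact sup_le (le_mabs_self _) (one_le_mabs _)
    · rw [mabs_div_comm]
      exact sup_le (le_mabs_self _) (one_le_mabs _)
    · refine sup_le ?_ (one_le_mabs _)
      rcases le_sup_iff.1 hb with hb | hb
      · exact (div_le_one'.2 hb).trans (one_le_mabs _)
      · rw [mabs_div_comm]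
        exact (div_le_div_right' hb _).trans (le_mabs_self _)

/-- The function `u / v ⊔ 1` is `1` wherever `u ≤ v`, so it is in general not regular. Instead, the
hypersurface function of `{i, j}` controls `|i / j|`, and that of `{i, j, b}` controls `b / (i ⊔
j)`. -/
theorem RegPCon_subset_latticeClosure [Nontrivial R]
    (hdiv : ∀ k : ℕ, k ≠ 0 → ∀ a : R, ∃ b : R, b ^ k = a)
    (hS : S = ratFun R n ∨ S = constKernel R n)
    (hle : S.toSubgroup ≤ (ratFun R n).toSubgroup) :
    RegPCon S ⊆ latticeClosure (CIPCon S ∩ RegPCon S) := by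
  classical
  rintro _ ⟨_, hf, rfl, h, g, rfl, hreg⟩
  have hL : IsSublattice (latticeClosure (CIPCon S ∩ RegPCon S)) := isSublattice_latticeClosure
  have hypersurface (P : Finset (Mono R n)) (hP : P.Nontrivial) :
      ∃ D, PositiveGen S (latticeClosure (CIPCon S ∩ RegPCon S)) D ∧
        (∀ x, |(h.eval / g.eval) x|ₘ ≤ D x ∨ ∀ p ∈ P, ∀ m : R,
          (∀ q ∈ P, q ≠ p → q.value x ≤ m) → p.value x / m ≤ D x) ∧
        ∀ x, ∀ i ∈ P, ∀ j ∈ P, i ≠ j → (∀ p ∈ P, p.value x ≤ i.value x ⊔ j.value x) →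
          D x ≤ |i.value x / j.value x|ₘ := by
    obtain ⟨F, hF, hgen, hlow, hupp⟩ := exists_hypersurface_fraction hP
    obtain ⟨D, hDS, hD, hDF, hDlow, hDgen⟩ := exists_truncation hS hf hF
    refine ⟨D, ⟨hDS, hD.one_le, subset_latticeClosure ⟨⟨D, hDS, rfl, hD.cornerIntegral⟩,
      D, hDS, rfl, (hDgen hgen).regular hdiv (hle hDS)⟩⟩, fun x => ?_, ?_⟩
    · exact (hDlow x).imp_right fun h p hp m hm => (hlow x p hp m hm).trans h
    · exact fun x i hi j hj hij hmax => (hDF x).trans (hupp x i hi j hj hij hmax)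
  choose! D hpos hlow hupp using hypersurface
  -- Regularity of `f` provides a dominant pair with `i ≠ j` at every point, so only pairs spanning
  -- a genuine hypersurface are needed.
  refine kernelSpan_div_mem hL hf ((h.monos ×ˢ g.monos).filter fun r => r.1 ≠ r.2)
    (fun r hr => Finset.mem_product.1 (Finset.mem_filter.1 hr).1) (fun x => ?_)
    fun r hr b => ?_
  · obtain ⟨i, hi, j, hj, hix, hjx, hij⟩ := hreg x
    exact ⟨(i, j), by simp [hi, hj, hij], hix, hjx⟩
  obtain ⟨i, j⟩ := r
  have hij : i ≠ j := (Finset.mem_filter.1 hr).2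
  have hP : ({i, j} : Finset (Mono R n)).Nontrivial := ⟨i, by simp, j, by simp, hij⟩
  have hQ : ({i, j, b} : Finset (Mono R n)).Nontrivial := ⟨i, by simp, j, by simp, hij⟩
  refine ⟨D {i, j} ⊔ D {i, j, b}, (hpos _ hP).sup hL (hpos _ hQ), fun x => ?_, fun x hb => ?_⟩
  · have h1 : D {i, j} x ≤ (D {i, j} ⊔ D {i, j, b}) x := le_sup_left
    have h2 : D {i, j, b} x ≤ (D {i, j} ⊔ D {i, j, b}) x := le_sup_right
    have hw : 1 ≤ (D {i, j} ⊔ D {i, j, b}) x := ((hpos _ hP).2.1 x).trans h1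
    generalize (D {i, j} ⊔ D {i, j, b}) x = w at h1 h2 hw
    rcases hlow _ hP x with h3 | h3
    · exact Or.inl (h3.trans h1)
    rcases hlow _ hQ x with h4 | h4
    · exact Or.inl (h4.trans h2)
    have hijw : i.value x / j.value x ≤ w :=
      (h3 i (by simp) (j.value x) (by simp +contextual)).trans h1
    have hjiw : j.value x / i.value x ≤ w :=
      (h3 j (by simp) (i.value x) (by simp +contextual)).trans h1
    -- All members of `{i, j, b}` other than `b` are at most `i ⊔ j`; this remains valid when `b` is
    -- `i` or `j`.
    have hmax : b.value x / (i.value x ⊔ j.value x) ≤ w :=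
      (h4 b (by simp) _ (by simp +contextual)).trans h2
    have hone {a : R} : a / a ≤ w := by rwa [div_self']
    right
    refine ⟨?_, ?_, mabs_le'.2 ⟨hijw, by rwa [inv_div]⟩⟩
    · rw [← div_mul_div_cancel _ (i.value x ⊔ j.value x), sq]
      refine mul_le_mul' hmax ?_
      rcases max_choice (i.value x) (j.value x) with h | h <;> rw [h]
      exacts [hone, hjiw]
    · rw [← div_mul_div_cancel _ (i.value x ⊔ j.value x), sq]
      refine mul_le_mul' hmax ?_
      rcases max_choice (i.value x) (j.value x) with h | h <;> rw [h]
      exacts [hijw, hone]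
  · exact sup_le (hupp _ hP x i (by simp) j (by simp) hij (by simp))
      (hupp _ hQ x i (by simp) j (by simp) hij (by simpa using hb))

theorem latticeClosure_CIPCon [Nontrivial R] (hS : S = ratFun R n ∨ S = constKernel R n) :
    latticeClosure (CIPCon S) = PCon S := by
  refine (latticeClosure_min ?_ (isSublattice_PCon S)).antisymm
    (PCon_subset_latticeClosure hS ?_)
  · rintro _ ⟨f, hf, rfl, -⟩
    exact ⟨f, hf, rfl⟩
  · rcases hS with rfl | rfl
    exacts [le_rfl, constKernel_le_ratFun]

theorem latticeClosure_CIPCon_inter_RegPCon [Nontrivial R]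
    (hdiv : ∀ k : ℕ, k ≠ 0 → ∀ a : R, ∃ b : R, b ^ k = a)
    (hS : S = ratFun R n ∨ S = constKernel R n) :
    latticeClosure (CIPCon S ∩ RegPCon S) = RegPCon S := by
  have hle : S.toSubgroup ≤ (ratFun R n).toSubgroup := by
    rcases hS with rfl | rfl
    exacts [le_rfl, constKernel_le_ratFun]
  exact (latticeClosure_min Set.inter_subset_right (isSublattice_RegPCon hdiv hle)).antisymm
    (RegPCon_subset_latticeClosure hdiv hS hle)

end Generation

end PrincipalKernels

open PrincipalKernels in
theorem mainTheorem7 {R : Type*} [CommGroup R] [LinearOrder R] [IsOrderedMonoid R]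
    [Nontrivial R] [MulArchimedean R]
    (hdiv : ∀ k : ℕ, k ≠ 0 → ∀ a : R, ∃ b : R, b ^ k = a)
    (hsup : ∀ s : Set R, s.Nonempty → BddAbove s → ∃ a, IsLUB s a)
    (hinf : ∀ s : Set R, s.Nonempty → BddBelow s → ∃ a, IsGLB s a)
    (n : ℕ) :
    (latticeClosure (CIPCon (ratFun R n)) = PCon (ratFun R n) ∧
      latticeClosure (CIPCon (ratFun R n) ∩ RegPCon (ratFun R n)) = RegPCon (ratFun R n)) ∧
    (latticeClosure (CIPCon (constKernel R n)) = PCon (constKernel R n) ∧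
      latticeClosure (CIPCon (constKernel R n) ∩ RegPCon (constKernel R n)) =
        RegPCon (constKernel R n)) := by
  exact ⟨⟨latticeClosure_CIPCon (Or.inl rfl), latticeClosure_CIPCon_inter_RegPCon hdiv (Or.inl rfl)⟩,
    latticeClosure_CIPCon (Or.inr rfl), latticeClosure_CIPCon_inter_RegPCon hdiv (Or.inr rfl)⟩
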